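/- Consider a single-server queue in which $n\in\mathbb N$ updates, numbered in order of generation, are generated at (and immediately arrive at) the times $0\le t_1\le\dots\le t_n$; write $\mathcal I=\{n,(t_i)_{i=1}^n\}$. Before time $0$ the system is empty, and the receiver initially holds information generated at some time $u_0\le 0$. The service times $S_1,\dots,S_n$ of the updates are independent exponential random variables with rate $\mu>0$. (This is the law, conditional on the arrival data $\mathcal I$, of a G/M/1 queue, in which the service times are i.i.d. exponential and independent of the arrivals.) Under a scheduling policy $\pi$, let $t_i'\in[0,\infty]$ be the time at which update $i$ is delivered ($t'_i=\infty$ if it is never served), let $$U_\pi(t)=\max\bigl(\{u_0\}\cup\{t_i : t_i'\le t\}\bigr)$$ be the generation time of the freshest update delivered by time $t$, and let $\Delta_\pi(t)=t-U_\pi(t)$ be the Age of Information (AoI). The following two policies are non-preemptive and idle only when there is nothing they can serve. - LCFS: whenever the server is free, it serves the last arrived update among all waiting updates, if any. - LCFS_I (informative LCFS): non-informative updates, i.e. waiting updates $i$ with $t_i\le U(t)$, whose delivery would not reduce the AoI, are discarded; whenever the server is free, it serves the last arrived update among the waiting informative ones, if any. (Updates generated at the same time are considered to arrive in the order of their numbers.)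 For real-valued processes write $\{X(t)\}_{t\ge0}\le_{\rm st}\{Y(t)\}_{t\ge0}$ if for every $k$, all times $0\le\tau_1<\dots<\tau_k$ and every (Borel) upper set $A\subseteq\mathbb R^k$ (i.e. $y\in A$ whenever $x\in A$ and $y\ge x$ coordinatewise), $$\mathbb P\bigl((X(\tau_1),\dots,X(\tau_k))\in A\bigr)\le\mathbb P\bigl((Y(\tau_1),\dots,Y(\tau_k))\in A\bigr).$$ Then, for every $\mathcal I$, every $u_0\le0$ and every $\mu>0$, the AoI process under LCFS_I is stochastically smaller than the AoI process under LCFS: $$\bigl[\{\Delta_{\rm LCFS\_I}(t),\,t\in[0,\infty)\}\,\big|\,\mathcal I\bigr]\ \le_{\rm st}\ \bigl[\{\Delta_{\rm LCFS}(t),\,t\in[0,\infty)\}\,\big|\,\mathcal I\bigr].$$ -/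

import Mathlib

noncomputable section

open scoped Classical NNReal

namespace AgeQueue

/-- Stochastic order of two real-valued processes indexed by `[0, ∞)`: all finite-dimensional
marginals are ordered on (Borel) upper sets of `ℝ^k` with the coordinatewise order. -/
def StochLE {Ω Ω' : Type*} [MeasurableSpace Ω] [MeasurableSpace Ω']
    (P : MeasureTheory.Measure Ω) (X : ℝ≥0 → Ω → ℝ)
    (Q : MeasureTheory.Measure Ω') (Y : ℝ≥0 → Ω' → ℝ) : Prop :=
  ∀ (k : ℕ) (τ : Fin k → ℝ≥0), StrictMono τ →
    ∀ A : Set (Fin k → ℝ), IsUpperSet A → MeasurableSet A →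
      P {ω | (fun i => X (τ i) ω) ∈ A} ≤ Q {ω | (fun i => Y (τ i) ω) ∈ A}

/-- The two non-preemptive scheduling policies: Last-Come-First-Served, which also serves
non-informative updates, and its informative version, which discards them. -/
inductive Policy where
  | LCFS : Policy
  | LCFS_I : Policy

/-- State of the queue at an epoch at which the server is free: the present epoch, and the delivery
time of each update, equal to `⊤` for an update that has not been served. -/
structure State (n : ℕ) where
  /-- the present epoch -/
  now : ℝ
  /-- the delivery times of the updates served so far -/
  deliv : Fin n → WithTop ℝ

/-- `U(x) = max {t i : deliv i ≤ x}`, the generation time of the freshest update among those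
delivered by time `x`; `u₀` is the generation time of the information held initially. -/
def freshest {n : ℕ} (u₀ : ℝ) (t : Fin n → ℝ) (deliv : Fin n → WithTop ℝ) (x : ℝ) : ℝ :=
  (insert u₀ ((Finset.univ.filter fun i => deliv i ≤ (x : WithTop ℝ)).image t)).max'
    (Finset.insert_nonempty _ _)

/-- Whether the policy is willing to serve an update generated at time `a` when the freshest
delivered update was generated at time `u`. An update is informative when `u < a`, that is, when its
delivery makes the age drop. -/
def Policy.Admits : Policy → ℝ → ℝ → Prop
  | .LCFS, _, _ => True
  | .LCFS_I, u, a => u < a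

/-- The updates, already arrived or still to arrive, that have not been served and that the policy
is willing to serve. -/
def candidates {n : ℕ} (π : Policy) (u₀ : ℝ) (t : Fin n → ℝ) (σ : State n) : Finset (Fin n) :=
  Finset.univ.filter fun i => σ.deliv i = ⊤ ∧ π.Admits (freshest u₀ t σ.deliv σ.now) (t i)

/-- The next epoch at which a service starts: now, if a candidate is waiting, and otherwise the
first arrival of a candidate. -/
def startTime {n : ℕ} (t : Fin n → ℝ) (σ : State n) (C : Finset (Fin n)) (hC : C.Nonempty) : ℝ :=
  max σ.now (C.inf' hC t)

theorem waiting_nonempty {n : ℕ} (t : Fin n → ℝ) (σ : State n) (C : Finset (Fin n))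
    (hC : C.Nonempty) : (C.filter fun i => t i ≤ startTime t σ C hC).Nonempty := by
  obtain ⟨i, hi, h⟩ := Finset.exists_mem_eq_inf' hC t
  exact ⟨i, Finset.mem_filter.2 ⟨hi, h ▸ le_max_right _ _⟩⟩

/-- One service, without preemption: as soon as a candidate is present, the server takes the last
arrived candidate among those present (updates are numbered in the order of arrival, so this is the
one with the largest index), and it is free again once that update, of size `S j`, is delivered. If
no candidate is left, nothing happens any more. -/
def step {n : ℕ} (π : Policy) (u₀ : ℝ) (t S : Fin n → ℝ) (σ : State n) : State n :=
  if hC : (candidates π u₀ t σ).Nonempty then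
    let s := startTime t σ (candidates π u₀ t σ) hC
    let j := ((candidates π u₀ t σ).filter fun i => t i ≤ s).max' (waiting_nonempty t σ _ hC)
    { now := s + S j
      deliv := Function.update σ.deliv j ((s + S j : ℝ) : WithTop ℝ) }
  else σ

/-- The delivery times of the `n` updates (`⊤` for an update that is never served), for a system
that is empty before time `0`, with arrival times `t` and service times `S`. Every service
concerns a new update, so that `n` steps exhaust the dynamics. -/
def deliveryTime {n : ℕ} (π : Policy) (u₀ : ℝ) (t S : Fin n → ℝ) : Fin n → WithTop ℝ :=
  ((step π u₀ t S)^[n] { now := 0, deliv := fun _ => ⊤ }).deliv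

/-- The age of information `Δ(x) = x - U(x)` at time `x`. -/
def age {n : ℕ} (π : Policy) (u₀ : ℝ) (t S : Fin n → ℝ) (x : ℝ≥0) : ℝ :=
  x - freshest u₀ t (deliveryTime π u₀ t S) x

end AgeQueue

end

noncomputable section

open scoped Classical NNReal ENNReal
open MeasureTheory ProbabilityTheory

namespace AgeQueue

/-! ### Dynamics -/

section Dynamics

variable {n : ℕ} {u₀ : ℝ} {t S : Fin n → ℝ}

/-! The two systems are coupled service by service rather than update by update, from states with a
common epoch in which LCFS_I's freshest delivery dominates LCFS's at every time. An update
informative for LCFS_I is then still unserved under LCFS, so LCFS starts its next service no later: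
at `s' ≤ s`, on updates `j` and `i` respectively. If LCFS finishes before `s`, then `j` is stale for
LCFS_I, which is idle meanwhile, so the domination survives. If LCFS is still busy at `s`,
memorylessness makes its residual service a fresh exponential, which is coupled with the service of
`i`; both deliveries then occur together, and `t j ≤ t i` preserves the domination.

No joint process is built: `prob` depends on the state alone, because served sizes are never read
again (`final_update`, `prob_eq_lintegral`). `le_lintegral_expMeasure` supplies memorylessness, and
`prob_LCFS_I_le_prob_LCFS` is the induction. -/

theorem freshest_le_iff {d : Fin n → WithTop ℝ} {x c : ℝ} :
    freshest u₀ t d x ≤ c ↔ u₀ ≤ c ∧ ∀ i, d i ≤ (x : WithTop ℝ) → t i ≤ c := by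
  simp [freshest, Finset.max'_le_iff]

theorem le_freshest {d : Fin n → WithTop ℝ} {x : ℝ} {i : Fin n} (h : d i ≤ (x : WithTop ℝ)) :
    t i ≤ freshest u₀ t d x :=
  (freshest_le_iff.1 le_rfl).2 i h

theorem init_le_freshest {d : Fin n → WithTop ℝ} {x : ℝ} : u₀ ≤ freshest u₀ t d x :=
  (freshest_le_iff.1 le_rfl).1

theorem freshest_mono {d : Fin n → WithTop ℝ} : Monotone (freshest u₀ t d) := fun _ _ hxy =>
  freshest_le_iff.2 ⟨init_le_freshest, fun _ hi =>
    le_freshest (hi.trans (WithTop.coe_le_coe.2 hxy))⟩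

/-- A new delivery can only make the freshest delivered update fresher. -/
theorem freshest_le_freshest_update {d : Fin n → WithTop ℝ} {j : Fin n} (hj : d j = ⊤) (s x : ℝ) :
    freshest u₀ t d x ≤ freshest u₀ t (Function.update d j (s : WithTop ℝ)) x := by
  refine freshest_le_iff.2 ⟨init_le_freshest, fun i hi => le_freshest ?_⟩
  have hij : i ≠ j := by
    rintro rfl
    simp [hj] at hi
  rwa [Function.update_of_ne hij]

/-- All recorded deliveries happened by the present epoch. -/
def State.Valid (σ : State n) : Prop :=
  ∀ i, σ.deliv i = ⊤ ∨ σ.deliv i ≤ (σ.now : WithTop ℝ)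

/-- The updates that have not been served. -/
def State.pending (σ : State n) : Finset (Fin n) :=
  Finset.univ.filter fun i => σ.deliv i = ⊤

/-- The state after the delivery of update `j` at time `x`. -/
def State.deliver (σ : State n) (j : Fin n) (x : ℝ) : State n where
  now := x
  deliv := Function.update σ.deliv j (x : WithTop ℝ)

/-- The last arrived update among the candidates present at the next start of a service. -/
def pick (t : Fin n → ℝ) (σ : State n) (C : Finset (Fin n)) (hC : C.Nonempty) : Fin n :=
  (C.filter fun i => t i ≤ startTime t σ C hC).max' (waiting_nonempty t σ C hC)

theorem pick_mem (σ : State n) {C : Finset (Fin n)} (hC : C.Nonempty) : pick t σ C hC ∈ C :=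
  (Finset.mem_filter.1 (Finset.max'_mem _ (waiting_nonempty t σ C hC))).1

theorem arrival_pick_le (σ : State n) {C : Finset (Fin n)} (hC : C.Nonempty) :
    t (pick t σ C hC) ≤ startTime t σ C hC :=
  (Finset.mem_filter.1 (Finset.max'_mem _ (waiting_nonempty t σ C hC))).2

theorem le_pick (σ : State n) {C : Finset (Fin n)} (hC : C.Nonempty) {i : Fin n} (hi : i ∈ C)
    (h : t i ≤ startTime t σ C hC) : i ≤ pick t σ C hC :=
  Finset.le_max' _ _ (Finset.mem_filter.2 ⟨hi, h⟩)

theorem now_le_startTime (σ : State n) {C : Finset (Fin n)} (hC : C.Nonempty) :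
    σ.now ≤ startTime t σ C hC :=
  le_max_left _ _

theorem startTime_le_of_mem (σ : State n) {C : Finset (Fin n)} (hC : C.Nonempty) {i : Fin n}
    (hi : i ∈ C) : startTime t σ C hC ≤ max σ.now (t i) :=
  max_le_max le_rfl (Finset.inf'_le t hi)

theorem startTime_anti {σ σ' : State n} (hσ : σ.now = σ'.now) {C D : Finset (Fin n)}
    (hC : C.Nonempty) (hD : D.Nonempty) (h : C ⊆ D) :
    startTime t σ' D hD ≤ startTime t σ C hC := by
  unfold startTime
  rw [hσ]
  exact max_le_max le_rfl (Finset.inf'_mono t h hC)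

theorem startTime_congr {σ σ' : State n} (hσ : σ.now ≤ σ'.now) {C : Finset (Fin n)}
    (hC : C.Nonempty) (h : σ'.now ≤ startTime t σ C hC) :
    startTime t σ' C hC = startTime t σ C hC := by
  unfold startTime at *
  exact le_antisymm (max_le h (le_max_right _ _)) (max_le_max hσ le_rfl)

theorem step_of_nonempty (π : Policy) (σ : State n) (hC : (candidates π u₀ t σ).Nonempty) :
    step π u₀ t S σ = σ.deliver (pick t σ _ hC)
      (startTime t σ _ hC + S (pick t σ _ hC)) := by
  rw [step, dif_pos hC]
  rfl

theorem step_of_empty (π : Policy) (σ : State n) (hC : ¬ (candidates π u₀ t σ).Nonempty) :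
    step π u₀ t S σ = σ := by
  rw [step, dif_neg hC]

theorem candidates_subset_pending (π : Policy) (σ : State n) :
    candidates π u₀ t σ ⊆ σ.pending := fun i hi => by
  simp only [candidates, State.pending, Finset.mem_filter] at hi ⊢
  exact ⟨hi.1, hi.2.1⟩

theorem mem_pending {σ : State n} {i : Fin n} : i ∈ σ.pending ↔ σ.deliv i = ⊤ := by
  simp [State.pending]

theorem candidates_LCFS (σ : State n) : candidates .LCFS u₀ t σ = σ.pending := by
  simp [candidates, State.pending, Policy.Admits]

theorem mem_candidates {π : Policy} {σ : State n} {i : Fin n} :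
    i ∈ candidates π u₀ t σ ↔
      σ.deliv i = ⊤ ∧ π.Admits (freshest u₀ t σ.deliv σ.now) (t i) := by
  simp [candidates]

/-- In a valid state a served update is already counted by `freshest`, so being informative forces
being unserved. -/
theorem mem_candidates_LCFS_I {σ : State n} (hσ : σ.Valid) {i : Fin n} :
    i ∈ candidates .LCFS_I u₀ t σ ↔ freshest u₀ t σ.deliv σ.now < t i :=
  mem_candidates.trans (and_iff_right_of_imp fun h =>
    (hσ i).resolve_right fun h' => (le_freshest h').not_gt h)

theorem pending_deliver (σ : State n) (j : Fin n) (x : ℝ) :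
    (σ.deliver j x).pending = σ.pending.erase j := by
  ext i
  rw [Finset.mem_erase, mem_pending, mem_pending]
  by_cases h : i = j
  · subst h
    simp [State.deliver]
  · simp [State.deliver, h]

theorem State.Valid.deliver {σ : State n} (hσ : σ.Valid) {j : Fin n} {x : ℝ} (hx : σ.now ≤ x) :
    (σ.deliver j x).Valid := fun i => by
  by_cases h : i = j
  · subst h
    simp [State.deliver]
  · simp only [State.deliver, Function.update_of_ne h]
    exact (hσ i).imp_right fun h' => h'.trans (WithTop.coe_le_coe.2 hx)

theorem freshest_of_valid {σ : State n} (hσ : σ.Valid) {x : ℝ} (hx : σ.now ≤ x) :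
    freshest u₀ t σ.deliv x = freshest u₀ t σ.deliv σ.now := by
  refine le_antisymm (freshest_le_iff.2 ⟨init_le_freshest, fun i hi => le_freshest ?_⟩)
    (freshest_mono hx)
  refine (hσ i).resolve_left fun h => ?_
  simp [h] at hi

/-- After as many steps as there are pending updates, nothing happens any more. -/
theorem step_iterate_fixed (π : Policy) (k : ℕ) (σ : State n) (hk : σ.pending.card ≤ k) :
    step π u₀ t S ((step π u₀ t S)^[k] σ) = (step π u₀ t S)^[k] σ := by
  induction k generalizing σ with
  | zero =>
    refine step_of_empty π σ fun h => ?_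
    have := h.mono (candidates_subset_pending π σ)
    exact absurd this.card_pos (by omega)
  | succ k ih =>
    rw [Function.iterate_succ_apply]
    by_cases h : (candidates π u₀ t σ).Nonempty
    · refine ih _ ?_
      have hj := candidates_subset_pending π σ (pick_mem (t := t) σ h)
      rw [step_of_nonempty π σ h, pending_deliver, Finset.card_erase_of_mem hj]
      omega
    · rw [step_of_empty π σ h, Function.iterate_fixed (step_of_empty π σ h)]
      exact step_of_empty π σ h

/-- The state in which the system ends when it starts from `σ`. -/
def final (π : Policy) (u₀ : ℝ) (t S : Fin n → ℝ) (σ : State n) : State n :=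
  (step π u₀ t S)^[n] σ

/-- Since `n` steps exhaust the dynamics from any state, one more is harmless. The first service can
thus be split off without counting steps. -/
theorem final_step (π : Policy) (σ : State n) :
    final π u₀ t S (step π u₀ t S σ) = final π u₀ t S σ := by
  rw [final, final, ← Function.iterate_succ_apply, Function.iterate_succ_apply']
  exact step_iterate_fixed π n σ (by simpa using Finset.card_le_univ σ.pending)

theorem final_of_empty (π : Policy) (σ : State n) (hC : ¬ (candidates π u₀ t σ).Nonempty) :
    final π u₀ t S σ = σ :=
  Function.iterate_fixed (step_of_empty π σ hC) n

theorem deliv_step_ne_top (π : Policy) (σ : State n) {j : Fin n} (hj : σ.deliv j ≠ ⊤) :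
    (step π u₀ t S σ).deliv j ≠ ⊤ := by
  by_cases h : (candidates π u₀ t σ).Nonempty
  · rw [step_of_nonempty π σ h]
    simp only [State.deliver, Function.update_apply]
    split_ifs <;> simp [hj]
  · rwa [step_of_empty π σ h]

theorem step_update (π : Policy) (σ : State n) {j : Fin n} (hj : σ.deliv j ≠ ⊤) (r : ℝ) :
    step π u₀ t (Function.update S j r) σ = step π u₀ t S σ := by
  by_cases h : (candidates π u₀ t σ).Nonempty
  · have hp := mem_pending.1 (candidates_subset_pending π σ (pick_mem (t := t) σ h))
    rw [step_of_nonempty π σ h, step_of_nonempty π σ h, Function.update_of_ne]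
    rintro rfl
    exact hj hp
  · rw [step_of_empty π σ h, step_of_empty π σ h]

/-- The evolution does not depend on the size of an update that has been served already. -/
theorem final_update (π : Policy) (σ : State n) {j : Fin n} (hj : σ.deliv j ≠ ⊤) (r : ℝ) :
    final π u₀ t (Function.update S j r) σ = final π u₀ t S σ := by
  have key (k : ℕ) : ∀ σ : State n, σ.deliv j ≠ ⊤ →
      (step π u₀ t (Function.update S j r))^[k] σ = (step π u₀ t S)^[k] σ := by
    induction k with
    | zero => exact fun _ _ => rfl
    | succ k ih =>
      intro σ hj
      rw [Function.iterate_succ_apply, Function.iterate_succ_apply, step_update π σ hj,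
        ih _ (deliv_step_ne_top π σ hj)]
  exact key n σ hj

/-- Letting time pass until the next service starts does not change the deliveries. -/
theorem deliv_final_of_idle (π : Policy) {σ : State n} (hσ : σ.Valid) {x : ℝ} (hx : σ.now ≤ x)
    (h : ∀ hC : (candidates π u₀ t σ).Nonempty, x ≤ startTime t σ _ hC) :
    (final π u₀ t S { now := x, deliv := σ.deliv }).deliv = (final π u₀ t S σ).deliv := by
  -- No delivery is recorded after `σ.now`, so the freshest generation time, and with it the
  -- candidate set, is the same at `x`.
  have hcand : candidates π u₀ t { now := x, deliv := σ.deliv } = candidates π u₀ t σ := by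
    simp only [candidates, freshest_of_valid hσ hx]
  by_cases hC : (candidates π u₀ t σ).Nonempty
  · rw [← final_step, ← final_step π σ, step_of_nonempty π σ hC,
      step_of_nonempty π _ (hcand ▸ hC)]
    simp only [hcand]
    have hs : startTime t { now := x, deliv := σ.deliv } _ hC = startTime t σ _ hC :=
      startTime_congr (σ := σ) hx hC (h hC)
    simp only [pick, hs]
    rfl
  · rw [final_of_empty π σ hC, final_of_empty π _ (by rwa [hcand])]

end Dynamics

/-! ### Measurability -/

section Measurability

variable {n : ℕ} {u₀ : ℝ} {t : Fin n → ℝ} {Ω : Type*} [MeasurableSpace Ω]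

/-- A function given by a measurable formula on each piece of a countable measurable partition is
measurable. -/
theorem measurable_of_countable_cases {ι β : Type*} [Countable ι] [MeasurableSpace β]
    {g : Ω → ι} (hg : ∀ c, MeasurableSet {ω | g ω = c}) {F : ι → Ω → β}
    (hF : ∀ c, Measurable (F c)) : Measurable fun ω => F (g ω) ω := by
  intro B hB
  have : (fun ω => F (g ω) ω) ⁻¹' B = ⋃ c, {ω | g ω = c} ∩ F c ⁻¹' B := by
    ext ω
    simp
  rw [this]
  exact MeasurableSet.iUnion fun c => (hg c).inter (hF c hB)

theorem measurable_freshest {d : Ω → Fin n → WithTop ℝ} (hd : ∀ i, Measurable fun ω => d ω i)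
    {x : Ω → ℝ} (hx : Measurable x) : Measurable fun ω => freshest u₀ t (d ω) (x ω) := by
  refine measurable_of_Iic fun c => ?_
  have : (fun ω => freshest u₀ t (d ω) (x ω)) ⁻¹' Set.Iic c =
      {_ω | u₀ ≤ c} ∩ ⋂ i, ({ω | d ω i ≤ (x ω : WithTop ℝ)}ᶜ ∪ {_ω | t i ≤ c}) := by
    ext ω
    simp [freshest_le_iff, imp_iff_not_or]
  rw [this]
  exact (MeasurableSet.const _).inter <| MeasurableSet.iInter fun i =>
    (measurableSet_le (hd i) hx.withTop_coe).compl.union (MeasurableSet.const _)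

/-- A random state is measurable when its epoch and its delivery times are. -/
def MeasurableState (σ : Ω → State n) : Prop :=
  (Measurable fun ω => (σ ω).now) ∧ ∀ i, Measurable fun ω => (σ ω).deliv i

theorem measurableSet_admits (π : Policy) {u : Ω → ℝ} (hu : Measurable u) (a : ℝ) :
    MeasurableSet {ω | π.Admits (u ω) a} := by
  cases π
  · exact MeasurableSet.const _
  · exact measurableSet_lt hu measurable_const

theorem measurableSet_candidates_eq (π : Policy) {σ : Ω → State n} (hσ : MeasurableState σ)
    (C : Finset (Fin n)) : MeasurableSet {ω | candidates π u₀ t (σ ω) = C} := by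
  have : {ω | candidates π u₀ t (σ ω) = C} = ⋂ i, {ω | ((σ ω).deliv i = ⊤ ∧
      π.Admits (freshest u₀ t (σ ω).deliv (σ ω).now) (t i)) ↔ i ∈ C} := by
    ext ω
    simp [Finset.ext_iff, mem_candidates]
  rw [this]
  refine MeasurableSet.iInter fun i => MeasurableSet.iff ?_ (MeasurableSet.const _)
  exact ((hσ.2 i) (measurableSet_singleton ⊤)).inter
    (measurableSet_admits π (measurable_freshest hσ.2 hσ.1) (t i))

theorem measurable_startTime {σ : Ω → State n} (hσ : MeasurableState σ) (C : Finset (Fin n))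
    (hC : C.Nonempty) : Measurable fun ω => startTime t (σ ω) C hC :=
  hσ.1.max measurable_const

theorem measurableSet_pick_eq {σ : Ω → State n} (hσ : MeasurableState σ) (C : Finset (Fin n))
    (hC : C.Nonempty) (j : Fin n) : MeasurableSet {ω | pick t (σ ω) C hC = j} := by
  have : {ω | pick t (σ ω) C hC = j} = {ω | j ∈ C ∧ t j ≤ startTime t (σ ω) C hC} ∩
      ⋂ i, ({ω | i ∈ C ∧ t i ≤ startTime t (σ ω) C hC}ᶜ ∪ {_ω | i ≤ j}) := by
    ext ω
    simp only [pick, Set.mem_ofPred_eq, Finset.max'_eq_iff, Finset.mem_filter, Set.mem_inter_iff,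
      Set.mem_iInter, Set.mem_union, Set.mem_compl_iff, imp_iff_not_or]
  have hm (i : Fin n) : MeasurableSet {ω | i ∈ C ∧ t i ≤ startTime t (σ ω) C hC} :=
    (MeasurableSet.const _).inter (measurableSet_le measurable_const (measurable_startTime hσ C hC))
  rw [this]
  exact (hm j).inter <| MeasurableSet.iInter fun i => (hm i).compl.union (MeasurableSet.const _)

theorem MeasurableState.deliver {σ : Ω → State n} (hσ : MeasurableState σ) (j : Fin n)
    {x : Ω → ℝ} (hx : Measurable x) : MeasurableState fun ω => (σ ω).deliver j (x ω) := by
  refine ⟨hx, fun i => ?_⟩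
  by_cases h : i = j
  · subst h
    simpa [State.deliver] using hx.withTop_coe
  · simpa [State.deliver, h] using hσ.2 i

theorem MeasurableState.of_countable_cases {ι : Type*} [Countable ι] {g : Ω → ι}
    (hg : ∀ c, MeasurableSet {ω | g ω = c}) {F : ι → Ω → State n}
    (hF : ∀ c, MeasurableState (F c)) : MeasurableState fun ω => F (g ω) ω :=
  ⟨measurable_of_countable_cases hg fun c => (hF c).1,
    fun i => measurable_of_countable_cases hg fun c => (hF c).2 i⟩

/-- The candidate set and the chosen update take finitely many values; once both are frozen, the new
state is an explicit measurable expression. -/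
theorem MeasurableState.step (π : Policy) {S : Ω → Fin n → ℝ} (hS : Measurable S)
    {σ : Ω → State n} (hσ : MeasurableState σ) :
    MeasurableState fun ω => step π u₀ t (S ω) (σ ω) := by
  let F (C : Finset (Fin n)) (ω : Ω) : State n :=
    if hC : C.Nonempty then (σ ω).deliver (pick t (σ ω) C hC)
      (startTime t (σ ω) C hC + S ω (pick t (σ ω) C hC)) else σ ω
  have hF (C : Finset (Fin n)) : MeasurableState (F C) := by
    by_cases hC : C.Nonempty
    · simp only [F, hC, dif_pos]
      exact MeasurableState.of_countable_cases (measurableSet_pick_eq hσ C hC)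
        (F := fun j ω => (σ ω).deliver j (startTime t (σ ω) C hC + S ω j))
        fun j => hσ.deliver j ((measurable_startTime hσ C hC).add
          ((measurable_pi_apply j).comp hS))
    · simpa only [F, hC, dif_neg, not_false_eq_true] using hσ
  convert MeasurableState.of_countable_cases
    (measurableSet_candidates_eq (u₀ := u₀) (t := t) π hσ) hF using 2 with ω
  by_cases hC : (candidates π u₀ t (σ ω)).Nonempty
  · rw [step_of_nonempty π _ hC]
    simp only [F, hC, dif_pos]
  · rw [step_of_empty π _ hC]
    simp only [F, hC, dif_neg, not_false_eq_true]

theorem MeasurableState.final (π : Policy) {S : Ω → Fin n → ℝ} (hS : Measurable S)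
    {σ : Ω → State n} (hσ : MeasurableState σ) :
    MeasurableState fun ω => final π u₀ t (S ω) (σ ω) := by
  have key (k : ℕ) : MeasurableState fun ω => (AgeQueue.step π u₀ t (S ω))^[k] (σ ω) := by
    induction k with
    | zero => exact hσ
    | succ k ih =>
      simp only [Function.iterate_succ_apply']
      exact ih.step π hS
  exact key n

end Measurability

/-! ### The exponential law -/

theorem ae_nonneg_expMeasure (μ : ℝ) : ∀ᵐ r ∂expMeasure μ, 0 ≤ r := by
  rw [ae_iff, expMeasure, gammaMeasure]
  have : {r : ℝ | ¬ 0 ≤ r} = Set.Iio 0 := by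
    ext
    simp
  rw [this, withDensity_apply _ measurableSet_Iio]
  exact lintegral_exponentialPDF_of_nonpos le_rfl

/-- Memorylessness of the exponential law. -/
theorem setLIntegral_Ici_expMeasure {μ a : ℝ} (ha : 0 ≤ a) (F : ℝ → ℝ≥0∞) :
    ∫⁻ r in Set.Ici a, F r ∂expMeasure μ =
      ENNReal.ofReal (Real.exp (-(μ * a))) * ∫⁻ r, F (a + r) ∂expMeasure μ := by
  have hpdf : Measurable (exponentialPDF μ) :=
    (measurable_exponentialPDFReal μ).ennreal_ofReal
  have hexp : expMeasure μ = volume.withDensity (exponentialPDF μ) := rfl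
  have hmap : (expMeasure μ).restrict (Set.Ici a) =
      ENNReal.ofReal (Real.exp (-(μ * a))) • (expMeasure μ).map (fun r => a + r) := by
    ext B hB
    rw [Measure.restrict_apply hB, Measure.smul_apply, smul_eq_mul,
      Measure.map_apply (measurable_const_add a) hB, hexp,
      withDensity_apply _ (hB.inter measurableSet_Ici),
      withDensity_apply _ (measurable_const_add a hB),
      ← lintegral_indicator (hB.inter measurableSet_Ici),
      ← lintegral_indicator (measurable_const_add a hB),
      ← lintegral_const_mul _ (hpdf.indicator (measurable_const_add a hB)),
      ← lintegral_add_left_eq_self _ a]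
    refine lintegral_congr fun r => ?_
    by_cases hr : a + r ∈ B <;> by_cases h0 : 0 ≤ r
    · have h1 : a + r ∈ B ∩ Set.Ici a := ⟨hr, by simpa using h0⟩
      have h2 : r ∈ (fun r => a + r) ⁻¹' B := hr
      rw [Set.indicator_of_mem h1, Set.indicator_of_mem h2, exponentialPDF_of_nonneg h0,
        exponentialPDF_of_nonneg (by positivity), ← ENNReal.ofReal_mul (Real.exp_nonneg _)]
      congr 1
      rw [mul_left_comm, ← Real.exp_add]
      ring_nf
    · have h1 : a + r ∉ B ∩ Set.Ici a := fun h => h0 (by simpa using h.2)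
      have h2 : r ∈ (fun r => a + r) ⁻¹' B := hr
      rw [Set.indicator_of_notMem h1, Set.indicator_of_mem h2,
        exponentialPDF_of_neg (not_le.1 h0), mul_zero]
    all_goals
      have h1 : a + r ∉ B ∩ Set.Ici a := fun h => hr h.1
      have h2 : r ∉ (fun r => a + r) ⁻¹' B := hr
      rw [Set.indicator_of_notMem h1, Set.indicator_of_notMem h2, mul_zero]
  -- Translation is a measurable embedding, so `F` need not be measurable.
  rw [hmap, lintegral_smul_measure, smul_eq_mul,
    (measurableEmbedding_addLeft a).lintegral_map]

/-- Resampling one coordinate does not change a product measure. -/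
theorem measurePreserving_update_pi {ι : Type*} [Fintype ι] [DecidableEq ι] (ν : Measure ℝ)
    [IsProbabilityMeasure ν] (j : ι) :
    MeasurePreserving (fun p : ℝ × (ι → ℝ) => Function.update p.2 j p.1)
      (ν.prod (Measure.pi fun _ => ν)) (Measure.pi fun _ => ν) := by
  have hm : Measurable fun p : ℝ × (ι → ℝ) => Function.update p.2 j p.1 := by
    refine measurable_pi_iff.2 fun i => ?_
    by_cases h : i = j
    · subst h
      simpa using measurable_fst
    · simpa [h, Function.comp_def] using (measurable_pi_apply i).comp measurable_snd
  refine ⟨hm, (Measure.pi_eq fun B hB => ?_).symm⟩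
  rw [Measure.map_apply hm (MeasurableSet.univ_pi hB)]
  -- The old coordinate `j` becomes unconstrained and contributes the total mass `1`.
  have : (fun p : ℝ × (ι → ℝ) => Function.update p.2 j p.1) ⁻¹' Set.univ.pi B =
      B j ×ˢ Set.univ.pi (Function.update B j Set.univ) := by
    ext ⟨r, S⟩
    simp only [Set.mem_preimage, Set.mem_univ_pi, Set.mem_prod]
    constructor
    · refine fun h => ⟨by simpa using h j, fun i => ?_⟩
      by_cases hi : i = j
      · subst hi
        simp
      · simpa [hi] using h i
    · rintro ⟨h, h'⟩ i
      by_cases hi : i = j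
      · subst hi
        simpa using h
      · simpa [hi] using h' i
  rw [this, Measure.prod_prod, Measure.pi_pi, ← Finset.mul_prod_erase _ _ (Finset.mem_univ j),
    ← Finset.mul_prod_erase Finset.univ (fun i => ν (B i)) (Finset.mem_univ j),
    Function.update_self, measure_univ, one_mul]
  congr 1
  exact Finset.prod_congr rfl fun i hi => by rw [Function.update_of_ne (Finset.ne_of_mem_erase hi)]

/-! ### Comparison of the two policies -/

section Comparison

variable {n k : ℕ} {u₀ : ℝ} {t : Fin n → ℝ} {τ : Fin k → ℝ≥0} {A : Set (Fin k → ℝ)}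

/-- The ages at the times `τ` when the delivery times are `d`. -/
def agePath (u₀ : ℝ) (t : Fin n → ℝ) (τ : Fin k → ℝ≥0) (d : Fin n → WithTop ℝ) : Fin k → ℝ :=
  fun l => τ l - freshest u₀ t d (τ l)

/-- The probability that the ages at the times `τ` belong to `A`, for a system that starts from the
state `σ` with independent service times of law `ν`. -/
def prob (ν : Measure ℝ) (π : Policy) (u₀ : ℝ) (t : Fin n → ℝ) (τ : Fin k → ℝ≥0)
    (A : Set (Fin k → ℝ)) (σ : State n) : ℝ≥0∞ :=
  Measure.pi (fun _ : Fin n => ν) {S | agePath u₀ t τ (final π u₀ t S σ).deliv ∈ A}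

theorem measurableSet_agePath_final (π : Policy) (hA : MeasurableSet A) {Ω : Type*}
    [MeasurableSpace Ω] {S : Ω → Fin n → ℝ} (hS : Measurable S) (σ : State n) :
    MeasurableSet {ω | agePath u₀ t τ (final π u₀ t (S ω) σ).deliv ∈ A} := by
  have hσ : MeasurableState fun _ : Ω => σ := ⟨measurable_const, fun _ => measurable_const⟩
  have : Measurable fun ω => agePath u₀ t τ (final π u₀ t (S ω) σ).deliv :=
    measurable_pi_iff.2 fun l =>
      measurable_const.sub (measurable_freshest (hσ.final π hS).2 measurable_const)
  exact this hA

theorem prob_of_idle {ν : Measure ℝ} (π : Policy) {σ : State n} (hσ : σ.Valid) {x : ℝ} (hx : σ.now ≤ x)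
    (h : ∀ hC : (candidates π u₀ t σ).Nonempty, x ≤ startTime t σ _ hC) :
    prob ν π u₀ t τ A { now := x, deliv := σ.deliv } = prob ν π u₀ t τ A σ := by
  simp only [prob, deliv_final_of_idle π hσ hx h]

variable {ν : Measure ℝ} [IsProbabilityMeasure ν]

theorem prob_of_empty (π : Policy) (σ : State n) (hC : ¬ (candidates π u₀ t σ).Nonempty) :
    prob ν π u₀ t τ A σ = if agePath u₀ t τ σ.deliv ∈ A then 1 else 0 := by
  simp only [prob, final_of_empty π σ hC]
  split_ifs with h <;> simp [h]

/-- The first service is sampled first, the others are independent of it. -/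
theorem prob_eq_lintegral (π : Policy) (hA : MeasurableSet A) (σ : State n)
    (hC : (candidates π u₀ t σ).Nonempty) :
    prob ν π u₀ t τ A σ = ∫⁻ r, prob ν π u₀ t τ A
      (σ.deliver (pick t σ _ hC) (startTime t σ _ hC + r)) ∂ν := by
  have hmp := measurePreserving_update_pi ν (pick t σ _ hC)
  have hE : MeasurableSet {S : Fin n → ℝ | agePath u₀ t τ (final π u₀ t S σ).deliv ∈ A} :=
    measurableSet_agePath_final π hA measurable_id σ
  rw [prob, ← hmp.measure_preimage hE.nullMeasurableSet,
    Measure.prod_apply (hmp.measurable hE)]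
  refine lintegral_congr fun r => congrArg _ ?_
  ext S
  simp only [Set.mem_preimage, Set.mem_ofPred_eq]
  -- The first service consumes the resampled size `r`; coordinate `j` is not read afterwards, so
  -- the original `S` can be restored.
  rw [← final_step, step_of_nonempty π σ hC, Function.update_self, final_update]
  simp [State.deliver]

theorem agePath_mem_of_freshest_le (hA : IsUpperSet A) {d d' : Fin n → WithTop ℝ}
    (h : ∀ x, freshest u₀ t d x ≤ freshest u₀ t d' x) (hd' : agePath u₀ t τ d' ∈ A) :
    agePath u₀ t τ d ∈ A :=
  hA (fun _ => sub_le_sub_left (h _) _) hd'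

/-- Used for simultaneous deliveries. The condition `d' i = ⊤` ensures that recording the new
delivery erases no earlier one. -/
theorem freshest_update_le_freshest_update {d d' : Fin n → WithTop ℝ}
    (h : ∀ x, freshest u₀ t d x ≤ freshest u₀ t d' x) {i j : Fin n} (hi : d' i = ⊤)
    (hij : t j ≤ t i) (s x : ℝ) :
    freshest u₀ t (Function.update d j (s : WithTop ℝ)) x ≤
      freshest u₀ t (Function.update d' i (s : WithTop ℝ)) x := by
  refine freshest_le_iff.2 ⟨init_le_freshest, fun l hl => ?_⟩
  by_cases hlj : l = j
  · subst hlj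
    rw [Function.update_self] at hl
    exact hij.trans (le_freshest (by rwa [Function.update_self]))
  · rw [Function.update_of_ne hlj] at hl
    exact (le_freshest hl).trans ((h x).trans (freshest_le_freshest_update hi s x))

/-- Before `s` the new delivery does not count, and from `s` on the other system already holds
something at least as fresh. Used when LCFS delivers a stale update. -/
theorem freshest_update_le {d d' : Fin n → WithTop ℝ}
    (h : ∀ x, freshest u₀ t d x ≤ freshest u₀ t d' x) {j : Fin n} {s : ℝ}
    (hj : t j ≤ freshest u₀ t d' s) (x : ℝ) :
    freshest u₀ t (Function.update d j (s : WithTop ℝ)) x ≤ freshest u₀ t d' x := by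
  refine freshest_le_iff.2 ⟨init_le_freshest, fun l hl => ?_⟩
  by_cases hlj : l = j
  · subst hlj
    rw [Function.update_self, WithTop.coe_le_coe] at hl
    exact hj.trans (freshest_mono hl)
  · rw [Function.update_of_ne hlj] at hl
    exact (le_freshest hl).trans (h x)

/-- By memorylessness, a lower bound may be checked separately for the services that end before
time `a`, and for those still running at time `a`, as if these had just started. -/
theorem le_lintegral_expMeasure {μ : ℝ} (hμ : 0 < μ) {a : ℝ} (ha : 0 ≤ a) {F : ℝ → ℝ≥0∞}
    {c : ℝ≥0∞} (h₁ : ∀ r, 0 ≤ r → r < a → c ≤ F r) (h₂ : c ≤ ∫⁻ r, F (a + r) ∂expMeasure μ) :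
    c ≤ ∫⁻ r, F r ∂expMeasure μ := by
  have := isProbabilityMeasure_expMeasure hμ
  calc c = ∫⁻ _, c ∂expMeasure μ := by simp
    _ = (∫⁻ _ in Set.Ici a, c ∂expMeasure μ) + ∫⁻ _ in (Set.Ici a)ᶜ, c ∂expMeasure μ :=
      (lintegral_add_compl _ measurableSet_Ici).symm
    _ ≤ (∫⁻ r in Set.Ici a, F r ∂expMeasure μ) + ∫⁻ r in (Set.Ici a)ᶜ, F r ∂expMeasure μ := by
      refine add_le_add ?_ ?_
      -- Memorylessness is applied to the constant `c` as well, so both sides carry the same factor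
      -- `exp (-(μ * a))`.
      · rw [setLIntegral_Ici_expMeasure ha, setLIntegral_Ici_expMeasure ha]
        exact mul_le_mul' le_rfl (by simpa using h₂)
      · refine lintegral_mono_ae ?_
        filter_upwards [ae_restrict_mem measurableSet_Ici.compl,
          ae_restrict_of_ae (ae_nonneg_expMeasure μ)] with r hr h0
        exact h₁ r h0 (not_le.1 hr)
    _ = ∫⁻ r, F r ∂expMeasure μ := lintegral_add_compl _ measurableSet_Ici

/-- The domination is required at all `x`, since some times in `τ` may precede the present epoch.
The induction counts the updates pending under LCFS: each round completes one LCFS service, whereas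
LCFS_I may stay idle. -/
theorem prob_LCFS_I_le_prob_LCFS {μ : ℝ} (hμ : 0 < μ) (ht : Monotone t) (hA : IsUpperSet A)
    (hAm : MeasurableSet A) {σ σ' : State n} (hσ : σ.Valid) (hσ' : σ'.Valid)
    (hnow : σ.now = σ'.now)
    (h : ∀ x, freshest u₀ t σ'.deliv x ≤ freshest u₀ t σ.deliv x) :
    prob (expMeasure μ) .LCFS_I u₀ t τ A σ ≤ prob (expMeasure μ) .LCFS u₀ t τ A σ' := by
  have := isProbabilityMeasure_expMeasure hμ
  induction hm : σ'.pending.card using Nat.strong_induction_on generalizing σ σ' with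
  | _ m ih =>
    subst hm
    have hsub : candidates .LCFS_I u₀ t σ ⊆ candidates .LCFS u₀ t σ' := fun i hi => by
      rw [mem_candidates_LCFS_I hσ] at hi
      rw [candidates_LCFS, mem_pending]
      refine (hσ' i).resolve_right fun h' => ?_
      rw [← hnow] at h'
      exact ((le_freshest h').trans (h _)).not_gt hi
    by_cases hD : (candidates .LCFS u₀ t σ').Nonempty
    swap
    · rw [prob_of_empty _ _ hD, prob_of_empty _ _ fun hC => hD (hC.mono hsub)]
      split_ifs with h₁ h₂
      · rfl
      · exact absurd (agePath_mem_of_freshest_le hA h h₁) h₂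
      · exact zero_le_one
      · rfl
    set j := pick t σ' _ hD
    set s' := startTime t σ' _ hD
    have hnow' : σ.now ≤ s' := hnow ▸ now_le_startTime σ' hD
    have hcard (x : ℝ) : (σ'.deliver j x).pending.card < σ'.pending.card := by
      rw [pending_deliver]
      exact Finset.card_erase_lt_of_mem (candidates_subset_pending _ _ (pick_mem σ' hD))
    -- LCFS delivers a non-informative update while the other system is idle
    have early (hjU : t j ≤ freshest u₀ t σ.deliv σ.now) {r : ℝ} (hr : 0 ≤ r)
        (hidle : ∀ hC : (candidates .LCFS_I u₀ t σ).Nonempty, s' + r ≤ startTime t σ _ hC) :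
        prob (expMeasure μ) .LCFS_I u₀ t τ A σ ≤
          prob (expMeasure μ) .LCFS u₀ t τ A (σ'.deliver j (s' + r)) := by
      have hx : σ.now ≤ s' + r := hnow'.trans (le_add_of_nonneg_right hr)
      rw [← prob_of_idle .LCFS_I hσ hx hidle]
      refine ih _ (hcard _) (fun i => (hσ i).imp_right fun h' =>
        h'.trans (WithTop.coe_le_coe.2 hx)) (hσ'.deliver (hnow ▸ hx)) rfl ?_ rfl
      exact freshest_update_le h (hjU.trans (freshest_mono hx))
    -- Updates that LCFS_I is not going to serve are not informative
    have stale (hjC : j ∉ candidates .LCFS_I u₀ t σ) : t j ≤ freshest u₀ t σ.deliv σ.now := by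
      rwa [mem_candidates_LCFS_I hσ, not_lt] at hjC
    rw [prob_eq_lintegral .LCFS hAm σ' hD]
    by_cases hC : (candidates .LCFS_I u₀ t σ).Nonempty
    swap
    · calc prob (expMeasure μ) .LCFS_I u₀ t τ A σ
          = ∫⁻ _, prob (expMeasure μ) .LCFS_I u₀ t τ A σ ∂expMeasure μ := by simp
        _ ≤ _ := by
          refine lintegral_mono_ae ?_
          filter_upwards [ae_nonneg_expMeasure μ] with r hr
          exact early (stale fun hjC => hC ⟨j, hjC⟩) hr fun hC' => absurd hC' hC
    set i := pick t σ _ hC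
    set s := startTime t σ _ hC
    have hss : s' ≤ s := startTime_anti hnow hC hD hsub
    have hi_top : σ.deliv i = ⊤ := (mem_candidates.1 (pick_mem σ hC)).1
    -- If `j` is informative it is present at `s`, where `i` is the last arrival; otherwise it is
    -- staler than any candidate.
    have hji : t j ≤ t i := by
      by_cases hjC : j ∈ candidates .LCFS_I u₀ t σ
      · exact ht (le_pick σ hC hjC ((arrival_pick_le σ' hD).trans hss))
      · exact (stale hjC).trans ((mem_candidates_LCFS_I hσ).1 (pick_mem σ hC)).le
    -- both systems are busy from time `s` on
    have late : prob (expMeasure μ) .LCFS_I u₀ t τ A σ ≤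
        ∫⁻ r, prob (expMeasure μ) .LCFS u₀ t τ A (σ'.deliver j (s' + (s - s' + r)))
          ∂expMeasure μ := by
      rw [prob_eq_lintegral .LCFS_I hAm σ hC]
      refine lintegral_mono_ae ?_
      filter_upwards [ae_nonneg_expMeasure μ] with r hr
      have hx : σ.now ≤ s + r := (now_le_startTime σ hC).trans (le_add_of_nonneg_right hr)
      have he : s' + (s - s' + r) = s + r := by ring
      rw [he]
      exact ih _ (hcard _) (hσ.deliver hx) (hσ'.deliver (hnow ▸ hx)) rfl
        (freshest_update_le_freshest_update h hi_top hji _) rfl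
    refine le_lintegral_expMeasure hμ (sub_nonneg.2 hss) (fun r hr hrs => ?_) late
    -- Here `s' < s`. Were `j`, present at `s'`, informative, LCFS_I would have started by `s'`.
    refine early (stale fun hjC => ?_) hr fun _ => by linarith
    have : s ≤ s' := (startTime_le_of_mem σ hC hjC).trans (max_le hnow' (arrival_pick_le σ' hD))
    linarith

end Comparison

/-- Independence makes the joint law of the service times the product measure used in `prob`. -/
theorem prob_initial {n k : ℕ} {u₀ : ℝ} {t : Fin n → ℝ} {τ : Fin k → ℝ≥0}
    {A : Set (Fin k → ℝ)} {Ω : Type*} [MeasurableSpace Ω] {P : Measure Ω}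
    [IsProbabilityMeasure P] {ν : Measure ℝ} {S : Fin n → Ω → ℝ}
    (hS : ∀ i, HasLaw (S i) ν P) (hindep : iIndepFun S P) (π : Policy) (hA : MeasurableSet A) :
    P {ω | (fun l => age π u₀ t (fun i => S i ω) (τ l)) ∈ A} =
      prob ν π u₀ t τ A { now := 0, deliv := fun _ => ⊤ } := by
  have hmap := (iIndepFun_iff_map_fun_eq_pi_map fun i => (hS i).aemeasurable).1 hindep
  simp only [fun i => (hS i).map_eq] at hmap
  have hE : MeasurableSet {S : Fin n → ℝ | agePath u₀ t τ
      (final π u₀ t S { now := 0, deliv := fun _ => ⊤ }).deliv ∈ A} :=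
    measurableSet_agePath_final π hA measurable_id _
  rw [prob, ← hmap, Measure.map_apply_of_aemeasurable
    (aemeasurable_pi_lambda _ fun i => (hS i).aemeasurable) hE]
  rfl

end AgeQueue

end

theorem mainTheorem1
    {Ω : Type*} [MeasurableSpace Ω] (P : MeasureTheory.Measure Ω)
    [MeasureTheory.IsProbabilityMeasure P]
    (n : ℕ) (t : Fin n → ℝ) (ht : Monotone t) (ht₀ : ∀ i, 0 ≤ t i)
    (u₀ : ℝ) (hu₀ : u₀ ≤ 0)
    (μ : ℝ) (hμ : 0 < μ) (S : Fin n → Ω → ℝ)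
    (hS : ∀ i, ProbabilityTheory.HasLaw (S i) (ProbabilityTheory.expMeasure μ) P)
    (hindep : ProbabilityTheory.iIndepFun S P) :
    AgeQueue.StochLE
      P (fun x ω => AgeQueue.age AgeQueue.Policy.LCFS_I u₀ t (fun i => S i ω) x)
      P (fun x ω => AgeQueue.age AgeQueue.Policy.LCFS u₀ t (fun i => S i ω) x) := by
  intro k τ _ A hA hAm
  rw [AgeQueue.prob_initial hS hindep _ hAm, AgeQueue.prob_initial hS hindep _ hAm]
  exact AgeQueue.prob_LCFS_I_le_prob_LCFS hμ ht hA hAm (fun _ => Or.inl rfl)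
    (fun _ => Or.inl rfl) rfl fun _ => le_rfl
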